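/- Let $p$ be a prime, $Q=p^s$ with $s\ge 1$, and $q=p^u$ with $u\ge 1$. Let $f\in\mathbb F_Q[x]$ be a polynomial whose degree is prime to $p$, and let $X$ be the smooth projective absolutely irreducible curve over $\mathbb F_Q$ defined by the affine equation $y^q-y=f(x)$ (a generalized Artin–Schreier curve). Let $g$ be its genus, and write its $L$-polynomial over $\mathbb F_Q$ as $$L_X(T)=\exp\Bigl(\sum_{i\ge 1}\bigl(\#X(\mathbb F_{Q^i})-Q^i-1\bigr)\frac{T^i}{i}\Bigr)=\sum_{i=0}^{2g}c_iT^i .$$ Let $\mathrm{ord}_p$ be the $p$-adic order, with $\mathrm{ord}_p(0)=\infty$, and let $NP(X/\mathbb F_Q)$ be the lower convex hull in the plane of the points $(i,\mathrm{ord}_p(c_i)/s)$, $0\le i\le 2g$, $c_i\ne 0$. Suppose that the first slope of $NP(X/\mathbb F_Q)$ (the slope of its leftmost segment) is $1/\sigma$, where $\sigma>0$ is a real number. Then $$\frac{\mathrm{ord}_p(c_i)}{s}\ \ge\ \frac{i}{\sigma}\qquad\text{for all } i=1,\dots,2g .$$ -/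

import Mathlib

open CategoryTheory AlgebraicGeometry Polynomial

universe u

noncomputable section

namespace GASCurve

/-! ### Curves over a field, rational points, genus -/

/-- `π : X ⟶ Spec k` is a complete smooth absolutely irreducible curve over the field `k`
(complete smooth curves over a field are automatically projective). -/
structure IsSmoothCompleteCurve {k : Type u} [Field k] {X : Scheme.{u}}
    (π : X ⟶ Spec (.of k)) : Prop where
  proper : IsProper π
  smooth : SmoothOfRelativeDimension 1 π
  geometricallyIntegral : GeometricallyIntegral π

/-- The `L`-rational points of the `k`-scheme `π : X ⟶ Spec k`, for a `k`-algebra `L`: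
the `k`-morphisms `Spec L ⟶ X`. -/
def RationalPoint {k : Type u} [Field k] {X : Scheme.{u}} (π : X ⟶ Spec (.of k))
    (L : Type u) [CommRing L] [Algebra k L] : Type u :=
  {x : Spec (.of L) ⟶ X // x ≫ π = Spec.map (CommRingCat.ofHom (algebraMap k L))}

/-- The extension of degree `n ≥ 1` of a finite field `k` with `Q` elements, i.e. the field with
`Q ^ n` elements, as a splitting field of `T ^ (Q ^ n) - T` over `k`. -/
abbrev Ext (k : Type u) [Field k] (n : ℕ) : Type u :=
  (X ^ (Nat.card k ^ n) - X : k[X]).SplittingField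

/-- The number of points of `X / k` over the extension of degree `n` of the finite field `k`. -/
def pointCount {k : Type u} [Field k] {X : Scheme.{u}} (π : X ⟶ Spec (.of k)) (n : ℕ) : ℕ :=
  Nat.card (RationalPoint π (Ext k n))

/-- The `k`-algebra structure on the function field of an integral `k`-scheme. -/
abbrev functionFieldAlgebra {k : Type u} [Field k] {X : Scheme.{u}} [IsIntegral X]
    (π : X ⟶ Spec (.of k)) : Algebra k X.functionField :=
  ((Scheme.ΓSpecIso (.of k)).inv ≫ π.appTop ≫
    X.presheaf.germ ⊤ (genericPoint X) trivial).hom.toAlgebra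

/-- The local ring of `X` at `x`, as a subring of the function field. -/
def localRing (X : Scheme.{u}) [IsIntegral X] (x : X) : Subring X.functionField :=
  (algebraMap (X.presheaf.stalk x) X.functionField).range

/-- The `k`-space of global regular differentials of a curve `X / k`: the rational differentials
which at every point `x` of `X` are of the form `∑ a_j d b_j` with `a_j`, `b_j` regular
at `x`. -/
def regularDifferentials {k : Type u} [Field k] {X : Scheme.{u}} [IsIntegral X]
    (π : X ⟶ Spec (.of k)) :
    letI := functionFieldAlgebra π
    Submodule k (Ω[X.functionField⁄k]) :=
  letI := functionFieldAlgebra π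
  ⨅ x : X, Submodule.span k
    {ω | ∃ a ∈ localRing X x, ∃ b ∈ localRing X x,
      ω = a • KaehlerDifferential.D k X.functionField b}

/-- The genus of a smooth complete curve: the dimension of its space of global regular
differentials. -/
def genus {k : Type u} [Field k] {X : Scheme.{u}} [IsIntegral X] (π : X ⟶ Spec (.of k)) : ℕ :=
  letI := functionFieldAlgebra π
  Module.finrank k (regularDifferentials π)

/-! ### Generalized Artin-Schreier curves -/

/-- The coordinate ring `k[x, y] / (y ^ q - y - f(x))` of the affine plane curve
`y ^ q - y = f(x)`. -/
abbrev CoordRing {k : Type u} [Field k] (q : ℕ) (f : k[X]) : Type u :=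
  AdjoinRoot (X ^ q - X - C f : k[X][X])

/-- `X / k` is the generalized Artin-Schreier curve with equation `y ^ q - y = f(x)`, where
`q = p ^ m` with `m ≥ 1` and `f` has degree prime to `p`: it is a smooth complete curve that
contains the affine plane curve with this equation as an open subscheme. -/
structure IsGeneralizedArtinSchreier {k : Type u} [Field k] (p m : ℕ) (f : k[X])
    {X : Scheme.{u}} (π : X ⟶ Spec (.of k)) : Prop where
  one_le : 1 ≤ m
  coprime : f.natDegree.Coprime p
  curve : IsSmoothCompleteCurve π
  model : ∃ j : Spec (.of (CoordRing (p ^ m) f)) ⟶ X, IsOpenImmersion j ∧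
    j ≫ π = Spec.map (CommRingCat.ofHom (algebraMap k (CoordRing (p ^ m) f)))

/-! ### The `L`-polynomial -/

/-- The `L`-polynomial of `X / 𝔽_Q`, as the power series
`exp (∑_{i ≥ 1} (#X(𝔽_{Q ^ i}) - Q ^ i - 1) T ^ i / i)` with rational coefficients. -/
def LSer {k : Type u} [Field k] {X : Scheme.{u}} (π : X ⟶ Spec (.of k)) : PowerSeries ℚ :=
  (PowerSeries.exp ℚ).subst (PowerSeries.mk fun i : ℕ =>
    if i = 0 then 0 else ((pointCount π i : ℚ) - (Nat.card k : ℚ) ^ i - 1) / (i : ℚ))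

/-- The coefficient `c_i` of the `L`-polynomial. -/
def LCoeff {k : Type u} [Field k] {X : Scheme.{u}} (π : X ⟶ Spec (.of k)) (i : ℕ) : ℚ :=
  (LSer π).coeff i

/-! ### Newton polygons -/

/-- The `p`-adic order of a rational number, with `ord_p 0 = ∞`. -/
def ordP (p : ℕ) (c : ℚ) : EReal :=
  if c = 0 then ⊤ else ((padicValRat p c : ℝ) : EReal)

/-- The lower boundary of the convex hull of a set of points of the plane. -/
def lowerHull (S : Set (ℝ × ℝ)) : Set (ℝ × ℝ) :=
  {P | P ∈ convexHull ℝ S ∧ ∀ y : ℝ, (P.1, y) ∈ convexHull ℝ S → P.2 ≤ y}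

/-- `N` starts (at its leftmost point) with a segment of positive length and slope `l`. -/
def HasFirstSlope (N : Set (ℝ × ℝ)) (l : ℝ) : Prop :=
  ∃ P ∈ N, (∀ R ∈ N, P.1 ≤ R.1) ∧
    ∃ ε : ℝ, 0 < ε ∧ ∀ t ∈ Set.Icc (0 : ℝ) ε, (P.1 + t, P.2 + l * t) ∈ N

/-- The normalized `p`-adic Newton polygon `NP(X / 𝔽_Q)`, `Q = p ^ s`: the lower convex hull of
the points `(i, ord_p(c_i) / s)`, `0 ≤ i ≤ 2 g`, with `c_i ≠ 0`. -/
def newtonPolygon {k : Type u} [Field k] {X : Scheme.{u}} [IsIntegral X] (p s : ℕ)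
    (π : X ⟶ Spec (.of k)) : Set (ℝ × ℝ) :=
  lowerHull {P | ∃ i : ℕ, i ≤ 2 * genus π ∧ P.1 = i ∧
    (P.2 : EReal) = ordP p (LCoeff π i) / (s : EReal)}

end GASCurve

end

namespace GASCurve

/-! Since `c_0 = 1`, the origin is one of the plotted points, and all the others lie strictly to its
right. Hence the Newton polygon starts at the origin, and its first segment lies on the line `y = x
/ σ`. A plotted point below that line would be joined to the origin by a chord inside the convex
hull, passing under the first segment; this contradicts the minimality of the lower hull.
`HasFirstSlope.mul_le` is this convexity argument, and `LCoeff_zero` supplies the starting point. -/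

/-- The constant term of the `L`-polynomial is `1`. -/
theorem LCoeff_zero {k : Type u} [Field k] {X : Scheme.{u}} (π : X ⟶ Spec (.of k)) :
    LCoeff π 0 = 1 := by
  have h₀ : PowerSeries.constantCoeff (PowerSeries.mk fun i : ℕ =>
      if i = 0 then 0 else ((pointCount π i : ℚ) - (Nat.card k : ℚ) ^ i - 1) / (i : ℚ)) = 0 := by
    simp
  rw [LCoeff, LSer, PowerSeries.coeff_subst' (PowerSeries.HasSubst.of_constantCoeff_zero' h₀),
    finsum_eq_single _ 0]
  · simp
  · intro d hd
    rw [PowerSeries.coeff_zero_eq_constantCoeff_apply, map_pow, h₀, zero_pow hd, smul_zero]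

/-- If all points of `S` lie in the right half plane and the origin is the only one of them on the
vertical axis, the same holds for the convex hull of `S`. -/
theorem convexHull_right_half_plane {S : Set (ℝ × ℝ)} (h₀ : ∀ P ∈ S, 0 ≤ P.1)
    (h₁ : ∀ P ∈ S, P.1 = 0 → P.2 = 0) :
    ∀ P ∈ convexHull ℝ S, 0 ≤ P.1 ∧ (P.1 = 0 → P.2 = 0) := by
  have hc : Convex ℝ {P : ℝ × ℝ | 0 ≤ P.1 ∧ (P.1 = 0 → P.2 = 0)} := by
    rintro ⟨x, y⟩ ⟨hx, hxy⟩ ⟨z, w⟩ ⟨hz, hzw⟩ a b ha hb -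
    simp only [Prod.smul_mk, smul_eq_mul, Prod.mk_add_mk, Set.mem_ofPred_eq] at *
    have hax := mul_nonneg ha hx
    have hbz := mul_nonneg hb hz
    refine ⟨add_nonneg hax hbz, fun h => ?_⟩
    have hax' : a * x = 0 := by linarith
    have hbz' : b * z = 0 := by linarith
    have hay : a * y = 0 := by
      rcases mul_eq_zero.1 hax' with h | h
      · simp [h]
      · simp [hxy h]
    have hbw : b * w = 0 := by
      rcases mul_eq_zero.1 hbz' with h | h
      · simp [h]
      · simp [hzw h]
    rw [hay, hbw, add_zero]
  exact fun P hP => convexHull_min (fun R hR => Set.mem_ofPred.2 ⟨h₀ R hR, h₁ R hR⟩) hc hP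

/-- If the lower convex hull of `S` starts at the origin with slope `l`, all of `S` lies on or above
the line of slope `l` through the origin. -/
theorem HasFirstSlope.mul_le {S : Set (ℝ × ℝ)} {l : ℝ} (hS : (0, 0) ∈ S)
    (h₀ : ∀ P ∈ S, 0 ≤ P.1) (h₁ : ∀ P ∈ S, P.1 = 0 → P.2 = 0)
    (h : HasFirstSlope (lowerHull S) l) {P : ℝ × ℝ} (hP : P ∈ S) : l * P.1 ≤ P.2 := by
  have hull := convexHull_right_half_plane h₀ h₁
  have hO := subset_convexHull ℝ S hS
  obtain ⟨R, hR, hleft, ε, hε, hseg⟩ := h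
  have hOmem : ((0, 0) : ℝ × ℝ) ∈ lowerHull S :=
    Set.mem_ofPred.2 ⟨hO, fun y hy => ((hull _ hy).2 rfl).ge⟩
  have hR1 : R.1 = 0 := le_antisymm (hleft _ hOmem) (hull R hR.1).1
  have hR2 : R.2 = 0 := (hull R hR.1).2 hR1
  rcases (h₀ P hP).eq_or_lt with hx | hx
  · rw [← hx, mul_zero, h₁ P hP hx.symm]
  -- The abscissa must lie both on the given initial segment (at most `ε`) and on the chord from the
  -- origin to `P` (at most `P.1`); there the segment is compared with the chord.
  have ht : 0 < min ε P.1 := lt_min hε hx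
  have hle := (hseg (min ε P.1) ⟨ht.le, min_le_left _ _⟩).2 (min ε P.1 / P.1 * P.2) (by
    have := (convex_convexHull ℝ S) hO (subset_convexHull ℝ S hP)
      (a := 1 - min ε P.1 / P.1) (b := min ε P.1 / P.1)
      (sub_nonneg.2 ((div_le_one hx).2 (min_le_right _ _))) (by positivity) (by ring)
    convert this using 1
    ext
    · simp [hR1, div_mul_cancel₀ _ hx.ne']
    · simp)
  simp only [hR2, zero_add] at hle
  have key : min ε P.1 / P.1 * (l * P.1) ≤ min ε P.1 / P.1 * P.2 := by
    calc min ε P.1 / P.1 * (l * P.1) = l * min ε P.1 := by field_simp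
      _ ≤ _ := hle
  exact le_of_mul_le_mul_left key (by positivity)

end GASCurve

theorem corollary2 (p : ℕ) (hp : p.Prime) (s : ℕ) (hs : 1 ≤ s)
    (k : Type u) [Field k] [Finite k] (hk : Nat.card k = p ^ s)
    (m : ℕ) (f : Polynomial k)
    (X : Scheme.{u}) [IsIntegral X] (π : X ⟶ Spec (.of k))
    (hX : GASCurve.IsGeneralizedArtinSchreier p m f π)
    (σ : ℝ) (hσ : 0 < σ)
    (hNP : GASCurve.HasFirstSlope (GASCurve.newtonPolygon p s π) (1 / σ)) :
    ∀ i : ℕ, 1 ≤ i → i ≤ 2 * GASCurve.genus π →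
      (((i : ℝ) / σ : ℝ) : EReal) ≤ GASCurve.ordP p (GASCurve.LCoeff π i) / (s : EReal) := by
  intro i _ hi
  have hord : GASCurve.ordP p (GASCurve.LCoeff π 0) / (s : EReal) = 0 := by
    simp [GASCurve.LCoeff_zero, GASCurve.ordP]
  -- A vanishing coefficient gives no point of the polygon, but its order is `⊤`, so the bound is
  -- trivial.
  by_cases hc : GASCurve.LCoeff π i = 0
  · rw [GASCurve.ordP, if_pos hc, EReal.top_div_of_pos_ne_top (by exact_mod_cast hs)
      (EReal.natCast_ne_top s)]
    exact le_top
  have hval : GASCurve.ordP p (GASCurve.LCoeff π i) / (s : EReal) =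
      (((padicValRat p (GASCurve.LCoeff π i) : ℝ) / (s : ℝ) : ℝ) : EReal) := by
    rw [GASCurve.ordP, if_neg hc, EReal.coe_div, EReal.coe_natCast]
  have hle := GASCurve.HasFirstSlope.mul_le
    (Set.mem_ofPred.2 ⟨0, Nat.zero_le _, by simp, by rw [hord]; rfl⟩)
    (by
      rintro P ⟨j, -, hj, -⟩
      rw [hj]
      exact Nat.cast_nonneg j)
    (by
      rintro P ⟨j, -, hj, hj'⟩ h
      obtain rfl : j = 0 := by exact_mod_cast hj.symm.trans h
      rw [hord] at hj'
      exact_mod_cast hj')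
    hNP (P := ((i : ℝ), (padicValRat p (GASCurve.LCoeff π i) : ℝ) / (s : ℝ)))
    (Set.mem_ofPred.2 ⟨i, hi, rfl, hval.symm⟩)
  rw [hval, EReal.coe_le_coe_iff]
  simpa [div_eq_inv_mul] using hle
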